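/- Let $(W,S)$ be a Coxeter system with length function $\ell$, with $W$ presented by generators $s\in S$ and relations $(st)^{n(s,t)}=e$ for $s,t\in S$ with $n(s,t)<\infty$, where $n(s,s)=1$ and $2\le n(s,t)=n(t,s)\le\infty$ for $s\ne t$. Let $u$ be an indeterminate and let $H$ be the Hecke algebra of $(W,S)$ over $\mathbb{Q}(u)$, that is, the $\mathbb{Q}(u)$-algebra with generators $T_s$ ($s\in S$) and relations $(T_s-u^2)(T_s+1)=0$ for $s \in S$ and $T_sT_tT_s\cdots=T_tT_sT_t\cdots$ ($n(s,t)$ factors on each side) for $s\neq t$ with $n(s,t)<\infty$; for $w \in W$ put $T_w=T_{s_1}\cdots T_{s_k}$ for any reduced expression $w=s_1\cdots s_k$. Let $\mathrm{ind}$ and $\mathrm{sgn}$ be the linear characters of $H$ determined by $\mathrm{ind}(T_w)=u^{2\ell(w)}$ and $\mathrm{sgn}(T_w)=(-1)^{\ell(w)}$ for $w \in W$. An $S$-labeled digraph $\Gamma$ is a directed multigraph without loops in which each edge is either solid or dashed and is labeled by an element of $S$, and such that for each $s\in S$ every vertex occurs in exactly one edge labeled $s$. Let $M(\Gamma)$ be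 the $\mathbb{Q}(u)$-vector space with basis the vertex set of $\Gamma$. For $s \in S$ let $\tau_s$ be the linear operator on $M(\Gamma)$ such that, for each edge labeled $s$ from $\alpha$ to $\beta$, \[\tau_s(\alpha)=\beta,\qquad \tau_s(\beta)=(u^2-1)\beta+u^2\alpha\] if the edge is solid, and \[\tau_s(\alpha)=u\alpha+(u+1)\beta,\qquad \tau_s(\beta)=(u^2-u-1)\beta+(u^2-u)\alpha\] if the edge is dashed. Call $\Gamma$ a $W$-digraph if $T_s\mapsto\tau_s$ ($s \in S$) extends to a homomorphism of $\mathbb{Q}(u)$-algebras from $H$ to the algebra of linear operators on $M(\Gamma)$; then $M(\Gamma)$ is an $H$-module. For a linear character $\lambda$ of $H$ put $M(\Gamma)_\lambda=\{v\in M(\Gamma): hv=\lambda(h)v\text{ for all }h\in H\}$. The connected components of $\Gamma$ are those of the underlying undirected multigraph, and a component is acyclic if it contains no nonempty directed circuit (solid and dashed edges alike being followed in their given direction). Let $\Gamma$ be a $W$-digraph with finitely many vertices. Then: (i) The number of connected components of $\Gamma$ is equal to $\dim M(\Gamma)_{\mathrm{ind}}$. (ii) If $n(s,t)<\infty$ for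 all $s,t\in S$, then the number of acyclic connected components of $\Gamma$ is equal to $\dim M(\Gamma)_{\mathrm{sgn}}$. -/

import Mathlib

open Module

noncomputable section

/-- The field `ℚ(u)` of rational functions in one indeterminate. -/
abbrev HeckeField : Type := RatFunc ℚ

/-- The indeterminate `u` of `ℚ(u)`. -/
def uVar : HeckeField := RatFunc.X

/-- The product `a b a b ⋯` with `n` factors, alternately `a` and `b`, starting with `a`. -/
def altProd {A : Type*} [Monoid A] (a b : A) : ℕ → A
  | 0 => 1
  | n + 1 => a * altProd b a n

section Hecke

variable {S W : Type*} [Group W] {M : CoxeterMatrix S}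

/-- The defining relations of the Hecke algebra on the free algebra with generators `T_s`, `s ∈ S`:
the quadratic relations `(T_s - u²)(T_s + 1) = 0` and the braid relations
`T_s T_t ⋯ = T_t T_s ⋯` (`n(s,t)` factors on each side) for `s ≠ t` with `n(s,t) < ∞`.
Following Mathlib's convention for Coxeter matrices, `M s t = 0` encodes `n(s,t) = ∞`. -/
inductive HeckeRel (M : CoxeterMatrix S) :
    FreeAlgebra HeckeField S → FreeAlgebra HeckeField S → Prop
  | quadratic (s : S) : HeckeRel M
      ((FreeAlgebra.ι HeckeField s - algebraMap HeckeField _ (uVar ^ 2)) *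
        (FreeAlgebra.ι HeckeField s + 1)) 0
  | braid (s t : S) (hst : s ≠ t) (hfin : M s t ≠ 0) : HeckeRel M
      (altProd (FreeAlgebra.ι HeckeField s) (FreeAlgebra.ι HeckeField t) (M s t))
      (altProd (FreeAlgebra.ι HeckeField t) (FreeAlgebra.ι HeckeField s) (M s t))

/-- The Hecke algebra `H` over `ℚ(u)` (with parameter `u²`) of the Coxeter system `(W, S)`. -/
abbrev HeckeAlgebra (_cs : CoxeterSystem M W) : Type _ := RingQuot (HeckeRel M)

namespace HeckeAlgebra

/-- The generator `T_s` of the Hecke algebra. -/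
def T (cs : CoxeterSystem M W) (s : S) : HeckeAlgebra cs :=
  RingQuot.mkAlgHom HeckeField (HeckeRel M) (FreeAlgebra.ι HeckeField s)

theorem map_altProd {A B F : Type*} [Monoid A] [Monoid B] [FunLike F A B] [MonoidHomClass F A B]
    (f : F) (a b : A) (n : ℕ) : f (altProd a b n) = altProd (f a) (f b) n := by
  induction n generalizing a b with
  | zero => simp [altProd]
  | succ n ih => simp [altProd, ih]

/-- The linear character of `H` with `T_s ↦ c` for all `s ∈ S`, where `c` is `u²` or `-1`. -/
def linearChar (cs : CoxeterSystem M W) (c : HeckeField) (hc : (c - uVar ^ 2) * (c + 1) = 0) :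
    HeckeAlgebra cs →ₐ[HeckeField] HeckeField :=
  RingQuot.liftAlgHom HeckeField
    ⟨FreeAlgebra.lift HeckeField (fun _ : S => c), by
      intro x y h
      cases h with
      | quadratic s => simpa using hc
      | braid s t _ _ => simp [map_altProd]⟩

@[simp]
theorem linearChar_T (cs : CoxeterSystem M W) (c : HeckeField)
    (hc : (c - uVar ^ 2) * (c + 1) = 0) (s : S) : linearChar cs c hc (T cs s) = c := by
  simp [linearChar, T]

/-- The index character `ind` of `H`, determined by `ind (T_w) = u ^ (2 ℓ(w))` for `w ∈ W`;
see `ind_reduced`. -/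
def ind (cs : CoxeterSystem M W) : HeckeAlgebra cs →ₐ[HeckeField] HeckeField :=
  linearChar cs (uVar ^ 2) (by ring)

/-- The sign character `sgn` of `H`, determined by `sgn (T_w) = (-1) ^ ℓ(w)` for `w ∈ W`;
see `sgn_reduced`. -/
def sgn (cs : CoxeterSystem M W) : HeckeAlgebra cs →ₐ[HeckeField] HeckeField :=
  linearChar cs (-1) (by ring)

/-- `ind (T_w) = u ^ (2 ℓ(w))`, where `T_w = T_{s₁} ⋯ T_{s_k}` for any reduced expression
`w = s₁ ⋯ s_k`. -/
theorem ind_reduced (cs : CoxeterSystem M W) (ω : List S) (hω : cs.IsReduced ω) :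
    ind cs (ω.map (T cs)).prod = uVar ^ (2 * cs.length (cs.wordProd ω)) := by
  have h : cs.length (cs.wordProd ω) = ω.length := hω
  rw [h, map_list_prod, List.map_map,
    show (ind cs ∘ T cs) = fun _ => uVar ^ 2 from funext fun s => linearChar_T cs _ _ s]
  simp [pow_mul]

/-- `sgn (T_w) = (-1) ^ ℓ(w)`, where `T_w = T_{s₁} ⋯ T_{s_k}` for any reduced expression
`w = s₁ ⋯ s_k`. -/
theorem sgn_reduced (cs : CoxeterSystem M W) (ω : List S) (hω : cs.IsReduced ω) :
    sgn cs (ω.map (T cs)).prod = (-1) ^ cs.length (cs.wordProd ω) := by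
  have h : cs.length (cs.wordProd ω) = ω.length := hω
  rw [h, map_list_prod, List.map_map,
    show (sgn cs ∘ T cs) = fun _ => (-1 : HeckeField) from
      funext fun s => linearChar_T cs _ _ s]
  simp

end HeckeAlgebra

end Hecke

/-- For a representation `ρ : A → gl(E)` of an algebra `A` on `E` and a linear character `χ` of `A`,
the subspace `E_χ = {v ∈ E | a v = χ(a) v for all a ∈ A}`. -/
def charSpace {K A E : Type*} [Field K] [Ring A] [Algebra K A] [AddCommGroup E] [Module K E]
    (ρ : A →ₐ[K] Module.End K E) (χ : A →ₐ[K] K) : Submodule K E where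
  carrier := {v | ∀ a : A, ρ a v = χ a • v}
  add_mem' := by
    intro v w hv hw a
    rw [map_add, hv a, hw a, smul_add]
  zero_mem' := by
    intro a
    simp
  smul_mem' := by
    intro c v hv a
    rw [map_smul, hv a, smul_comm]

/-- The two kinds of edges. -/
inductive EdgeKind : Type
  | solid
  | dashed

/-- A directed edge from `src` to `tgt`, solid or dashed, labeled by an element of `S`. -/
structure LabeledEdge (S V : Type*) where
  /-- solid or dashed -/
  kind : EdgeKind
  /-- the label -/
  label : S
  /-- the initial vertex -/
  src : V
  /-- the terminal vertex -/
  tgt : V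

/-- The vertex `α` is one of the two ends of the edge `e`. -/
def LabeledEdge.Incident {S V : Type*} (e : LabeledEdge S V) (α : V) : Prop :=
  e.src = α ∨ e.tgt = α

/-- An `S`-labeled digraph with vertex set `V`: there are no loops and, for every `s`, every vertex
occurs in exactly one edge labeled `s`. (So distinct edges differ in kind, label, or ends, and a
set of edges suffices to describe the multigraph.) -/
structure LabeledDigraph (S V : Type*) where
  /-- the set of edges -/
  edges : Set (LabeledEdge S V)
  no_loops : ∀ e ∈ edges, e.src ≠ e.tgt
  existsUnique_edge : ∀ (s : S) (α : V), ∃! e, e ∈ edges ∧ e.label = s ∧ e.Incident α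

namespace LabeledDigraph

variable {S V : Type*} (Γ : LabeledDigraph S V)

/-- The unique edge labeled `s` in which the vertex `α` occurs. -/
def edgeAt (s : S) (α : V) : LabeledEdge S V :=
  (Γ.existsUnique_edge s α).choose

theorem edgeAt_spec (s : S) (α : V) :
    Γ.edgeAt s α ∈ Γ.edges ∧ (Γ.edgeAt s α).label = s ∧ (Γ.edgeAt s α).Incident α :=
  (Γ.existsUnique_edge s α).choose_spec.1

open Classical in
/-- The vector `τ_s(α)` of `M(Γ)`. -/
def tauVec (s : S) (α : V) : V →₀ HeckeField :=
  let e := Γ.edgeAt s α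
  match e.kind with
  | .solid =>
      if e.src = α then Finsupp.single e.tgt 1
      else Finsupp.single α (uVar ^ 2 - 1) + Finsupp.single e.src (uVar ^ 2)
  | .dashed =>
      if e.src = α then Finsupp.single α uVar + Finsupp.single e.tgt (uVar + 1)
      else Finsupp.single α (uVar ^ 2 - uVar - 1) + Finsupp.single e.src (uVar ^ 2 - uVar)

/-- The linear operator `τ_s` on the vector space `M(Γ)` over `ℚ(u)` with basis the vertices. -/
def tau (s : S) : Module.End HeckeField (V →₀ HeckeField) :=
  Finsupp.linearCombination HeckeField (Γ.tauVec s)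

/-- `Γ` is a `W`-digraph if `T_s ↦ τ_s` extends to a representation of `H` on `M(Γ)`. -/
def IsWDigraph {W : Type*} [Group W] {M : CoxeterMatrix S} (cs : CoxeterSystem M W) : Prop :=
  ∃ ρ : HeckeAlgebra cs →ₐ[HeckeField] Module.End HeckeField (V →₀ HeckeField),
    ∀ s : S, ρ (HeckeAlgebra.T cs s) = Γ.tau s

/-- There is a directed edge from `α` to `β`. -/
def Step (α β : V) : Prop :=
  ∃ e ∈ Γ.edges, e.src = α ∧ e.tgt = β

/-- The undirected graph obtained from `Γ` by forgetting kinds, labels, directions and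
multiplicities of edges. -/
def undir : SimpleGraph V := SimpleGraph.fromRel Γ.Step

/-- The connected components of `Γ`. -/
abbrev Component : Type _ := Γ.undir.ConnectedComponent

variable {Γ}

/-- A connected component `C` of `Γ` is acyclic if there is no nonempty directed circuit in `C`.
(A directed path starting in `C` stays in `C`.) -/
def Component.IsAcyclic (C : Γ.Component) : Prop :=
  ∀ α ∈ C.supp, ¬ Relation.TransGen Γ.Step α α

variable {W : Type*} [Group W] {M : CoxeterMatrix S} {cs : CoxeterSystem M W}

/-- The representation of `H` on `M(Γ)` afforded by a `W`-digraph `Γ`. -/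
def IsWDigraph.rep (h : Γ.IsWDigraph cs) :
    HeckeAlgebra cs →ₐ[HeckeField] Module.End HeckeField (V →₀ HeckeField) :=
  h.choose

theorem IsWDigraph.rep_T (h : Γ.IsWDigraph cs) (s : S) :
    h.rep (HeckeAlgebra.T cs s) = Γ.tau s :=
  h.choose_spec s

/-- The representation is determined by `T_s ↦ τ_s`. -/
theorem IsWDigraph.eq_rep (h : Γ.IsWDigraph cs)
    (ρ : HeckeAlgebra cs →ₐ[HeckeField] Module.End HeckeField (V →₀ HeckeField))
    (hρ : ∀ s : S, ρ (HeckeAlgebra.T cs s) = Γ.tau s) : ρ = h.rep := by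
  apply RingQuot.ringQuot_ext'
  apply FreeAlgebra.hom_ext
  funext s
  exact (hρ s).trans (h.rep_T s).symm

end LabeledDigraph

end

/-! Along an edge, `τ_s` is a 2×2 matrix with eigenvalues `u²` and `-1`, so each eigenvector
condition fixes the ratio of the coefficients at source and target (`tau_eq_ind_iff`,
`tau_eq_neg_iff`). For `ind` the ratio is 1: eigenvectors are the functions constant on components,
which gives (i). For `sgn` it is `sgnRatio`, so a component contributes a line or nothing, according
to whether these ratios are consistent around closed walks.

Both sign ratios vanish at `u = 0`, so their product along a directed circuit is not 1. A sign
vector is therefore zero on the circuit, hence on its whole component (`apply_eq_zero_of_circuit`).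

On an acyclic component, set the coefficient at a vertex to the product of ratios along a directed
path to a sink. Independence of the path is Newman's lemma with weights (`unique_sink`), which needs
every fork of edges labeled `s`, `t` to close up with equal weights (`local_confluence`). To close
it, apply the antisymmetrizer of the dihedral Hecke algebra of `s`, `t` to the source of the fork;
the result `y` is a sign vector for both generators. At `u = 0` each `τ_s` sends a vertex to plus or
minus the target of its `s`-edge, and only the longest term of the antisymmetrizer survives. The two
alternating words for that term thus lead to one vertex `x`, where `y` is nonzero. Both branches of
the fork reach `x`, and comparing coefficients of `y` along them equates the weights. -/

open Polynomial

noncomputable section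

/-! ### Dihedral antisymmetrizers. -/

section Antisymmetrizer

variable {K A : Type*} [Field K] [Ring A] [Algebra K A]

/-- The antisymmetrizer `∑ (-1) ^ ℓ(w) q ^ (n - ℓ(w)) T_w` of the dihedral Hecke algebra with
generators `a`, `b` of parameter `q`, where `a b a ⋯ = b a b ⋯` with `n` factors. -/
def antisymmetrizer (q : K) (a b : A) : ℕ → A
  | 0 => 0
  | n + 1 => q • antisymmetrizer q a b n +
      (-1 : K) ^ n • ((algebraMap K A q - a) * altProd b a n)

/-- The recursion pairs each `T_w` with `a T_w`, so every summand has a left factor `q - a`, on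
which `a` acts by `-1`. Only the quadratic relation of `a` enters; the braid relation is needed just
to exchange `a` and `b`. -/
theorem mul_antisymmetrizer {q : K} {a : A} (ha : (a - algebraMap K A q) * (a + 1) = 0) (b : A)
    (n : ℕ) : a * antisymmetrizer q a b n = -antisymmetrizer q a b n := by
  induction n with
  | zero => simp [antisymmetrizer]
  | succ n ih =>
    have hc : a * algebraMap K A q = algebraMap K A q * a := (Algebra.commutes q a).symm
    have h : a * (algebraMap K A q - a) = -(algebraMap K A q - a) := by
      have h2 : a * a = algebraMap K A q * a + algebraMap K A q - a := by
        have : (a - algebraMap K A q) * (a + 1) =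
          a * a - (algebraMap K A q * a + algebraMap K A q - a) := by noncomm_ring
        rw [this] at ha
        exact sub_eq_zero.1 ha
      rw [mul_sub, h2, hc]
      abel
    rw [antisymmetrizer, mul_add, mul_smul_comm, ih, mul_smul_comm, ← mul_assoc, h]
    simp only [neg_mul, smul_neg]
    abel

/-- The two sums have the same terms of length less than `n`; they differ only in which alternating
word represents the longest element. -/
theorem antisymmetrizer_sub_swap (q : K) (a b : A) (n : ℕ) :
    antisymmetrizer q a b n - antisymmetrizer q b a n =
      (-1 : K) ^ n • (altProd a b n - altProd b a n) := by
  induction n with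
  | zero => simp [antisymmetrizer, altProd]
  | succ n ih =>
    have h : antisymmetrizer q a b (n + 1) - antisymmetrizer q b a (n + 1) =
        q • (antisymmetrizer q a b n - antisymmetrizer q b a n) +
        (-1 : K) ^ n • (q • (altProd b a n - altProd a b n) -
          (altProd a b (n + 1) - altProd b a (n + 1))) := by
      simp only [antisymmetrizer, altProd, Algebra.smul_def, sub_mul, mul_sub]
      abel
    rw [h, ih, smul_comm q, ← smul_add, pow_succ, mul_smul]
    congr 1
    rw [neg_one_smul, smul_sub, smul_sub]
    abel

theorem antisymmetrizer_swap {q : K} {a b : A} {n : ℕ} (h : altProd a b n = altProd b a n) :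
    antisymmetrizer q a b n = antisymmetrizer q b a n := by
  rw [← sub_eq_zero, antisymmetrizer_sub_swap, h, sub_self, smul_zero]

end Antisymmetrizer

/-- A vector lies in the eigenspace of a linear character as soon as the generators `T_s` act on it
correctly. -/
theorem mem_charSpace_iff {S W E : Type*} [Group W] {M : CoxeterMatrix S} {cs : CoxeterSystem M W}
    [AddCommGroup E] [Module HeckeField E] (ρ : HeckeAlgebra cs →ₐ[HeckeField] End HeckeField E)
    (χ : HeckeAlgebra cs →ₐ[HeckeField] HeckeField) (v : E) :
    v ∈ charSpace ρ χ ↔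
      ∀ s, ρ (HeckeAlgebra.T cs s) v = χ (HeckeAlgebra.T cs s) • v := by
  refine ⟨fun h s => h _, fun h a => ?_⟩
  obtain ⟨a, rfl⟩ := RingQuot.mkAlgHom_surjective HeckeField (HeckeRel M) a
  induction a using FreeAlgebra.induction with
  | grade0 r => simp [Algebra.algebraMap_eq_smul_one]
  | grade1 s => exact h s
  | mul a b ha hb =>
    rw [map_mul, map_mul, map_mul, Module.End.mul_apply, hb, map_smul, ha, smul_smul, mul_comm]
  | add a b ha hb => simp only [map_add, LinearMap.add_apply, ha, hb, add_smul]

/-! ### Rational functions in `u` and the edge ratios. -/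

theorem uVar_eq : uVar = algebraMap ℚ[X] HeckeField X := by
  simp [uVar, RatFunc.algebraMap_X]

theorem uVar_ne_zero : uVar ≠ 0 := RatFunc.X_ne_zero

theorem uVar_add_ne_zero (c : ℚ) : uVar + algebraMap ℚ[X] HeckeField (C c) ≠ 0 := by
  rw [uVar_eq, ← map_add]
  exact RatFunc.algebraMap_ne_zero (X_add_C_ne_zero c)

theorem uVar_add_one_ne_zero : uVar + 1 ≠ 0 := by simpa using uVar_add_ne_zero 1

theorem uVar_sub_one_ne_zero : uVar - 1 ≠ 0 := by
  simpa [sub_eq_add_neg] using uVar_add_ne_zero (-1)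

/-- The ratio of the coefficients at the source and at the target of an edge, for a vector on which
the generators `T_s` act by `-1`. -/
def EdgeKind.sgnRatio : EdgeKind → HeckeField
  | .solid => -uVar ^ 2
  | .dashed => -(uVar ^ 2 - uVar) / (uVar + 1)

theorem EdgeKind.sgnRatio_ne_zero (k : EdgeKind) : k.sgnRatio ≠ 0 := by
  cases k
  · exact neg_ne_zero.2 (pow_ne_zero _ uVar_ne_zero)
  · refine div_ne_zero (neg_ne_zero.2 ?_) uVar_add_one_ne_zero
    rw [show uVar ^ 2 - uVar = uVar * (uVar - 1) by ring]
    exact mul_ne_zero uVar_ne_zero uVar_sub_one_ne_zero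

/-- The rational function `w` vanishes at `u = 0`. -/
def VanishesAtZero (w : HeckeField) : Prop :=
  ∃ p q : ℚ[X], p.eval 0 = 1 ∧ w * algebraMap _ _ p = algebraMap _ _ (X * q)

theorem VanishesAtZero.mul {v w : HeckeField} (hv : VanishesAtZero v) (hw : VanishesAtZero w) :
    VanishesAtZero (v * w) := by
  obtain ⟨p, q, hp, h⟩ := hv
  obtain ⟨p', q', hp', h'⟩ := hw
  refine ⟨p * p', q * (X * q'), by simp [hp, hp'], ?_⟩
  rw [← mul_assoc X, map_mul, map_mul _ (X * q), ← h, ← h']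
  ring

theorem VanishesAtZero.ne_one {w : HeckeField} (hw : VanishesAtZero w) : w ≠ 1 := by
  rintro rfl
  obtain ⟨p, q, hp, h⟩ := hw
  rw [one_mul] at h
  rw [RatFunc.algebraMap_injective ℚ h] at hp
  simp at hp

/-- The dashed ratio is `u (1 - u) / (u + 1)`, not a polynomial; its denominator is 1 at `u = 0`,
which is why vanishing is formulated with denominators. -/
theorem EdgeKind.vanishesAtZero_sgnRatio (k : EdgeKind) : VanishesAtZero k.sgnRatio := by
  cases k
  · refine ⟨1, -X, by simp, ?_⟩
    simp only [sgnRatio, uVar_eq, map_mul, map_neg, map_one]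
    ring
  · refine ⟨X + 1, 1 - X, by simp, ?_⟩
    have h := uVar_add_one_ne_zero
    simp only [map_mul, map_add, map_one, map_sub, ← uVar_eq, sgnRatio]
    field_simp
    ring

/-! ### The operators `τ_s` and their eigenvectors. -/

namespace LabeledDigraph

variable {S V : Type*} {Γ : LabeledDigraph S V}

theorem edgeAt_eq {e : LabeledEdge S V} (he : e ∈ Γ.edges) {α : V} (h : e.Incident α) :
    Γ.edgeAt e.label α = e :=
  (Γ.existsUnique_edge e.label α).unique (Γ.edgeAt_spec e.label α) ⟨he, rfl, h⟩

theorem edgeAt_src {e : LabeledEdge S V} (he : e ∈ Γ.edges) : Γ.edgeAt e.label e.src = e :=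
  edgeAt_eq he (Or.inl rfl)

theorem edgeAt_tgt {e : LabeledEdge S V} (he : e ∈ Γ.edges) : Γ.edgeAt e.label e.tgt = e :=
  edgeAt_eq he (Or.inr rfl)

theorem tauVec_apply_of_not_incident {s : S} {α β : V} (h : ¬ (Γ.edgeAt s α).Incident β) :
    Γ.tauVec s α β = 0 := by
  have h1 : (Γ.edgeAt s α).src ≠ β := fun h' => h (Or.inl h')
  have h2 : (Γ.edgeAt s α).tgt ≠ β := fun h' => h (Or.inr h')
  have h3 : α ≠ β := by
    rintro rfl
    exact h (Γ.edgeAt_spec s α).2.2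
  unfold tauVec
  cases hk : (Γ.edgeAt s α).kind <;> simp only [hk] <;> split_ifs <;>
    simp [h1.symm, h2.symm, h3.symm]

theorem tauVec_src {e : LabeledEdge S V} (he : e ∈ Γ.edges) :
    Γ.tauVec e.label e.src = match e.kind with
      | .solid => Finsupp.single e.tgt 1
      | .dashed => Finsupp.single e.src uVar + Finsupp.single e.tgt (uVar + 1) := by
  unfold tauVec
  rw [edgeAt_src he]
  cases hk : e.kind <;> simp [hk]

theorem tauVec_tgt {e : LabeledEdge S V} (he : e ∈ Γ.edges) :
    Γ.tauVec e.label e.tgt = match e.kind with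
      | .solid => Finsupp.single e.tgt (uVar ^ 2 - 1) + Finsupp.single e.src (uVar ^ 2)
      | .dashed => Finsupp.single e.tgt (uVar ^ 2 - uVar - 1) +
          Finsupp.single e.src (uVar ^ 2 - uVar) := by
  unfold tauVec
  rw [edgeAt_tgt he]
  cases hk : e.kind <;> simp [hk, Γ.no_loops e he]

theorem tau_single (s : S) (α : V) : Γ.tau s (Finsupp.single α 1) = Γ.tauVec s α := by
  simp [tau]

/-- A coefficient of `τ_s(y)` depends only on the two coefficients of `y` along the edge. -/
theorem tau_apply {e : LabeledEdge S V} (he : e ∈ Γ.edges) {β : V} (hβ : e.Incident β)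
    (y : V →₀ HeckeField) : Γ.tau e.label y β =
      y e.src * Γ.tauVec e.label e.src β + y e.tgt * Γ.tauVec e.label e.tgt β := by
  classical
  induction y using Finsupp.induction_linear with
  | zero => simp
  | add f g hf hg =>
    rw [map_add, Finsupp.add_apply, hf, hg, Finsupp.add_apply, Finsupp.add_apply]
    ring
  | single γ c =>
    have hne := Γ.no_loops e he
    have h0 : Γ.tau e.label (Finsupp.single γ c) β = c * Γ.tauVec e.label γ β := by simp [tau]
    rw [h0]
    by_cases h1 : γ = e.src
    · subst h1
      simp [Finsupp.single_eq_of_ne hne.symm]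
    by_cases h2 : γ = e.tgt
    · subst h2
      simp [Finsupp.single_eq_of_ne hne]
    rw [tauVec_apply_of_not_incident, Finsupp.single_eq_of_ne (Ne.symm h1),
      Finsupp.single_eq_of_ne (Ne.symm h2)]
    · simp
    · intro h
      have h3 := edgeAt_eq (Γ.edgeAt_spec e.label γ).1 h
      have h4 := (Γ.edgeAt_spec e.label γ).2.2
      rw [(Γ.edgeAt_spec e.label γ).2.1, edgeAt_eq he hβ] at h3
      rw [← h3] at h4
      exact h4.elim (fun h => h1 h.symm) fun h => h2 h.symm

theorem tau_apply_src {e : LabeledEdge S V} (he : e ∈ Γ.edges) (y : V →₀ HeckeField) :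
    Γ.tau e.label y e.src = match e.kind with
      | .solid => uVar ^ 2 * y e.tgt
      | .dashed => uVar * y e.src + (uVar ^ 2 - uVar) * y e.tgt := by
  have hne := Γ.no_loops e he
  rw [tau_apply he (Or.inl rfl), tauVec_src he, tauVec_tgt he]
  cases e.kind <;> simp [Finsupp.single_eq_of_ne hne] <;> ring

theorem tau_apply_tgt {e : LabeledEdge S V} (he : e ∈ Γ.edges) (y : V →₀ HeckeField) :
    Γ.tau e.label y e.tgt = match e.kind with
      | .solid => y e.src + (uVar ^ 2 - 1) * y e.tgt
      | .dashed => (uVar + 1) * y e.src + (uVar ^ 2 - uVar - 1) * y e.tgt := by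
  have hne := (Γ.no_loops e he).symm
  rw [tau_apply he (Or.inr rfl), tauVec_src he, tauVec_tgt he]
  cases e.kind <;> simp [Finsupp.single_eq_of_ne hne] <;> ring

/-- To verify an identity at all vertices it suffices to verify it at both ends of each edge
labeled `s`. -/
theorem forall_vertex {s : S} {p : V → Prop}
    (h : ∀ e ∈ Γ.edges, e.label = s → p e.src ∧ p e.tgt) (α : V) : p α := by
  obtain ⟨h1, h2, h3 | h3⟩ := Γ.edgeAt_spec s α
  · exact h3 ▸ (h _ h1 h2).1
  · exact h3 ▸ (h _ h1 h2).2

/-- The eigenspace on each edge is a line, already cut out by the equation at the source; the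
equation at the target then follows. -/
theorem tau_eq_ind_iff (s : S) (y : V →₀ HeckeField) :
    Γ.tau s y = uVar ^ 2 • y ↔ ∀ e ∈ Γ.edges, e.label = s → y e.src = y e.tgt := by
  constructor
  · rintro h e he rfl
    have h1 := tau_apply_src he y
    rw [h, Finsupp.smul_apply, smul_eq_mul] at h1
    cases hk : e.kind <;> simp only [hk] at h1
    · exact mul_left_cancel₀ (pow_ne_zero 2 uVar_ne_zero) h1
    · refine mul_left_cancel₀ (mul_ne_zero uVar_ne_zero uVar_sub_one_ne_zero) ?_
      linear_combination h1
  · refine fun h => Finsupp.ext (forall_vertex (Γ := Γ) (s := s) ?_)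
    rintro e he rfl
    have h1 := h e he rfl
    rw [tau_apply_src he, tau_apply_tgt he, Finsupp.smul_apply, Finsupp.smul_apply, h1]
    cases e.kind <;> constructor <;> simp only [smul_eq_mul] <;> ring

theorem tau_eq_neg_iff (s : S) (y : V →₀ HeckeField) :
    Γ.tau s y = -y ↔
      ∀ e ∈ Γ.edges, e.label = s → y e.src = e.kind.sgnRatio * y e.tgt := by
  have hu := uVar_add_one_ne_zero
  constructor
  · rintro h e he rfl
    have h1 := tau_apply_src he y
    rw [h, Finsupp.neg_apply] at h1
    cases hk : e.kind <;> simp only [hk, EdgeKind.sgnRatio] at h1 ⊢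
    · linear_combination -h1
    · field_simp
      linear_combination -h1
  · refine fun h => Finsupp.ext (forall_vertex (Γ := Γ) (s := s) ?_)
    rintro e he rfl
    have h1 := h e he rfl
    rw [tau_apply_src he, tau_apply_tgt he, Finsupp.neg_apply, Finsupp.neg_apply, h1]
    cases e.kind <;> constructor <;> simp only [EdgeKind.sgnRatio] <;> field_simp <;> ring

end LabeledDigraph

/-! ### Specialization at `u = 0`. -/

namespace LabeledDigraph

variable {S V : Type*} {Γ : LabeledDigraph S V}

/-- The vectors of `M(Γ)` all of whose coefficients lie in the `ℚ[u]`-submodule `J` of `ℚ(u)`. -/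
def coeffLattice (V : Type*) (J : Submodule ℚ[X] HeckeField) :
    Submodule ℚ[X] (V →₀ HeckeField) where
  carrier := {y | ∀ β, y β ∈ J}
  add_mem' hy hz β := J.add_mem (hy β) (hz β)
  zero_mem' _ := J.zero_mem
  smul_mem' c _ hy β := J.smul_mem c (hy β)

theorem mul_mem_of_eq_algebraMap {J : Submodule ℚ[X] HeckeField} {x y : HeckeField} (p : ℚ[X])
    (hp : algebraMap _ _ p = x) (hy : y ∈ J) : x * y ∈ J := by
  rw [← hp, ← Algebra.smul_def]
  exact J.smul_mem p hy

/-- The matrix entries of `τ_s` are polynomials in `u`. With `J` generated by 1 or by `u`, this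
makes reduction at `u = 0` compatible with `τ_s`. -/
theorem tau_mem_coeffLattice {J : Submodule ℚ[X] HeckeField} (s : S) {y : V →₀ HeckeField}
    (hy : y ∈ coeffLattice V J) : Γ.tau s y ∈ coeffLattice V J := by
  refine forall_vertex (Γ := Γ) (s := s) ?_
  rintro e he rfl
  rw [tau_apply_src he, tau_apply_tgt he]
  have h1 := hy e.src
  have h2 := hy e.tgt
  cases e.kind <;> constructor <;> simp only []
  · exact mul_mem_of_eq_algebraMap (X ^ 2) (by simp [uVar_eq]) h2
  · exact J.add_mem h1 (mul_mem_of_eq_algebraMap (X ^ 2 - 1) (by simp [uVar_eq]) h2)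
  · exact J.add_mem (mul_mem_of_eq_algebraMap X (by simp [uVar_eq]) h1)
      (mul_mem_of_eq_algebraMap (X ^ 2 - X) (by simp [uVar_eq]) h2)
  · exact J.add_mem (mul_mem_of_eq_algebraMap (X + 1) (by simp [uVar_eq]) h1)
      (mul_mem_of_eq_algebraMap (X ^ 2 - X - 1) (by simp [uVar_eq]) h2)

theorem smul_mem_coeffLattice {J : Submodule ℚ[X] HeckeField} {x : HeckeField}
    {y : V →₀ HeckeField} (p : ℚ[X]) (hp : algebraMap _ _ p = x) (hy : y ∈ coeffLattice V J) :
    x • y ∈ coeffLattice V J :=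
  fun β => mul_mem_of_eq_algebraMap p hp (hy β)

theorem altProd_tau_mem_coeffLattice {J : Submodule ℚ[X] HeckeField} (s t : S) (n : ℕ)
    {y : V →₀ HeckeField} (hy : y ∈ coeffLattice V J) :
    altProd (Γ.tau s) (Γ.tau t) n y ∈ coeffLattice V J := by
  induction n generalizing s t with
  | zero => exact hy
  | succ n ih => exact tau_mem_coeffLattice s (ih t s)

theorem antisymmetrizer_mem_coeffLattice {J : Submodule ℚ[X] HeckeField} (s t : S) (n : ℕ)
    {y : V →₀ HeckeField} (hy : y ∈ coeffLattice V J) :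
    antisymmetrizer (uVar ^ 2) (Γ.tau s) (Γ.tau t) n y ∈ coeffLattice V J := by
  have h2 : algebraMap ℚ[X] HeckeField (X ^ 2) = uVar ^ 2 := by simp [uVar_eq]
  induction n with
  | zero => exact Submodule.zero_mem _
  | succ n ih =>
    have h := altProd_tau_mem_coeffLattice (Γ := Γ) t s n hy
    exact Submodule.add_mem _ (smul_mem_coeffLattice _ h2 ih)
      (smul_mem_coeffLattice ((-1) ^ n) (by simp)
        (Submodule.sub_mem _ (smul_mem_coeffLattice _ h2 h) (tau_mem_coeffLattice s h)))

/-- The vectors of `M(Γ)` that vanish at `u = 0`. -/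
def vanishingLattice (V : Type*) : Submodule ℚ[X] (V →₀ HeckeField) :=
  coeffLattice V (ℚ[X] ∙ uVar)

/-- The vectors of `M(Γ)` with polynomial coefficients. -/
def polynomialLattice (V : Type*) : Submodule ℚ[X] (V →₀ HeckeField) :=
  coeffLattice V (ℚ[X] ∙ (1 : HeckeField))

theorem smul_mem_vanishingLattice {x : HeckeField} {y : V →₀ HeckeField} (p : ℚ[X])
    (hp : algebraMap _ _ (X * p) = x) (hy : y ∈ polynomialLattice V) :
    x • y ∈ vanishingLattice V := by
  intro β
  obtain ⟨q, hq⟩ := Submodule.mem_span_singleton.1 (hy β)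
  refine Submodule.mem_span_singleton.2 ⟨p * q, ?_⟩
  rw [Finsupp.smul_apply, ← hq, ← hp, uVar_eq]
  rw [smul_eq_mul, Algebra.smul_def, Algebra.smul_def, map_mul, map_mul]
  ring

theorem single_mem_polynomialLattice (α : V) :
    Finsupp.single α (1 : HeckeField) ∈ polynomialLattice V := by
  classical
  intro β
  rw [Finsupp.single_apply]
  split_ifs
  · exact Submodule.mem_span_singleton_self _
  · exact Submodule.zero_mem _

theorem one_notMem_span_uVar : (1 : HeckeField) ∉ (ℚ[X] ∙ uVar) := by
  intro h
  obtain ⟨p, hp⟩ := Submodule.mem_span_singleton.1 h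
  refine VanishesAtZero.ne_one ⟨1, p, by simp, ?_⟩ rfl
  rw [map_one, one_mul, ← hp, uVar_eq, Algebra.smul_def, map_mul, mul_comm]

/-- At `u = 0` the vector `y` becomes the vertex `α`, up to sign. -/
def SpecializesTo (y : V →₀ HeckeField) (α : V) : Prop :=
  ∃ ε : HeckeField, (ε = 1 ∨ ε = -1) ∧ y - ε • Finsupp.single α 1 ∈ vanishingLattice V

/-- Otherwise `u` would divide the sign `ε`. -/
theorem SpecializesTo.apply_notMem {y : V →₀ HeckeField} {α : V} (h : SpecializesTo y α) :
    y α ∉ (ℚ[X] ∙ uVar) := by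
  obtain ⟨ε, hε, h⟩ := h
  intro hy
  have h1 := Submodule.sub_mem _ hy (h α)
  rcases hε with rfl | rfl
  · simp only [Finsupp.sub_apply, Finsupp.smul_apply, Finsupp.single_eq_same, smul_eq_mul,
      sub_sub_cancel, mul_one] at h1
    exact one_notMem_span_uVar h1
  · simp only [Finsupp.sub_apply, Finsupp.smul_apply, Finsupp.single_eq_same, smul_eq_mul,
      sub_sub_cancel, mul_one] at h1
    exact one_notMem_span_uVar (by simpa using Submodule.neg_mem _ h1)

theorem SpecializesTo.apply_ne_zero {y : V →₀ HeckeField} {α : V} (h : SpecializesTo y α) :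
    y α ≠ 0 := fun h0 => h.apply_notMem (h0 ▸ Submodule.zero_mem _)

theorem SpecializesTo.unique {y : V →₀ HeckeField} {α β : V} (hα : SpecializesTo y α)
    (hβ : SpecializesTo y β) : α = β := by
  by_contra hne
  obtain ⟨ε, -, h⟩ := hβ
  have h1 := h α
  rw [Finsupp.sub_apply, Finsupp.smul_apply, Finsupp.single_eq_of_ne hne, smul_zero,
    sub_zero] at h1
  exact hα.apply_notMem h1

theorem SpecializesTo.neg {y : V →₀ HeckeField} {α : V} (h : SpecializesTo y α) :
    SpecializesTo (-y) α := by
  obtain ⟨ε, hε, h⟩ := h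
  refine ⟨-ε, by rcases hε with rfl | rfl <;> simp, ?_⟩
  rw [neg_smul, ← neg_sub']
  exact Submodule.neg_mem _ h

theorem SpecializesTo.of_sub_mem {y z : V →₀ HeckeField} {α : V} (h : SpecializesTo y α)
    (hz : z - y ∈ vanishingLattice V) : SpecializesTo z α := by
  obtain ⟨ε, hε, h⟩ := h
  exact ⟨ε, hε, by simpa using Submodule.add_mem _ hz h⟩

theorem specializesTo_single (α : V) : SpecializesTo (Finsupp.single α 1) α :=
  ⟨1, Or.inl rfl, by simp⟩

theorem SpecializesTo.neg_one_pow_smul {y : V →₀ HeckeField} {α : V} (h : SpecializesTo y α)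
    (n : ℕ) : SpecializesTo ((-1 : HeckeField) ^ n • y) α := by
  rcases neg_one_pow_eq_or HeckeField n with h1 | h1 <;> rw [h1]
  · simpa using h
  · simpa using h.neg

/-- At `u = 0` solid and dashed edges act alike: the source goes to the target, and the target to
minus itself. -/
theorem specializesTo_tau_single (s : S) (α : V) :
    SpecializesTo (Γ.tau s (Finsupp.single α 1)) (Γ.edgeAt s α).tgt := by
  rw [tau_single]
  obtain ⟨he, hs, h⟩ := Γ.edgeAt_spec s α
  generalize Γ.edgeAt s α = e at *
  have key (β : V) (p : ℚ[X]) (x : HeckeField) (hp : algebraMap _ _ (X * p) = x) :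
      x • Finsupp.single β (1 : HeckeField) ∈ vanishingLattice V :=
    smul_mem_vanishingLattice p hp (single_mem_polynomialLattice β)
  subst hs
  rcases h with rfl | rfl
  · refine (specializesTo_single e.tgt).of_sub_mem ?_
    rw [tauVec_src he]
    cases e.kind
    · simp
    · convert Submodule.add_mem _ (key e.src 1 uVar (by simp [uVar_eq]))
        (key e.tgt 1 uVar (by simp [uVar_eq])) using 1
      simp [Finsupp.single_add]
      abel
  · refine (specializesTo_single e.tgt).neg.of_sub_mem ?_
    rw [tauVec_tgt he]
    cases e.kind
    · convert Submodule.add_mem _ (key e.tgt X (uVar ^ 2) (by simp [uVar_eq, sq]))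
        (key e.src X (uVar ^ 2) (by simp [uVar_eq, sq])) using 1
      simp [Finsupp.single_sub]
      abel
    · convert Submodule.add_mem _
        (key e.tgt (X - 1) (uVar ^ 2 - uVar) (by simp [uVar_eq, mul_sub, sq]))
        (key e.src (X - 1) (uVar ^ 2 - uVar) (by simp [uVar_eq, mul_sub, sq])) using 1
      simp [Finsupp.single_sub]
      abel

theorem SpecializesTo.tau {y : V →₀ HeckeField} {α : V} (h : SpecializesTo y α) (s : S) :
    SpecializesTo (Γ.tau s y) (Γ.edgeAt s α).tgt := by
  obtain ⟨ε, hε, h⟩ := h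
  have h1 : SpecializesTo (Γ.tau s (ε • Finsupp.single α 1)) (Γ.edgeAt s α).tgt := by
    rw [map_smul]
    have h2 := specializesTo_tau_single (Γ := Γ) s α
    rcases hε with rfl | rfl
    · simpa using h2
    · simpa using h2.neg
  refine h1.of_sub_mem ?_
  rw [← map_sub]
  exact tau_mem_coeffLattice s h

/-- The vertex reached from `α` by `n` alternate moves to the target of the edge labeled `s` or
`t`, the last one along `s`. -/
def push (Γ : LabeledDigraph S V) (s t : S) (n : ℕ) (α : V) : V :=
  match n with
  | 0 => α
  | n + 1 => (Γ.edgeAt s (push Γ t s n α)).tgt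

theorem specializesTo_altProd (s t : S) (n : ℕ) (α : V) :
    SpecializesTo (altProd (Γ.tau s) (Γ.tau t) n (Finsupp.single α 1)) (Γ.push s t n α) := by
  induction n generalizing s t with
  | zero => exact specializesTo_single α
  | succ n ih => exact (ih t s).tau s

theorem specializesTo_antisymmetrizer (s t : S) (n : ℕ) (α : V) :
    SpecializesTo (antisymmetrizer (uVar ^ 2) (Γ.tau s) (Γ.tau t) (n + 1) (Finsupp.single α 1))
      (Γ.push s t (n + 1) α) := by
  refine ((specializesTo_altProd s t (n + 1) α).neg.neg_one_pow_smul n).of_sub_mem ?_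
  have h1 := single_mem_polynomialLattice α
  -- Every term except the longest word carries a factor `u²`.
  have h2 : antisymmetrizer (uVar ^ 2) (Γ.tau s) (Γ.tau t) (n + 1) (Finsupp.single α 1) -
      (-1 : HeckeField) ^ n • -(altProd (Γ.tau s) (Γ.tau t) (n + 1) (Finsupp.single α 1)) =
      uVar ^ 2 • (antisymmetrizer (uVar ^ 2) (Γ.tau s) (Γ.tau t) n (Finsupp.single α 1) +
        (-1 : HeckeField) ^ n • altProd (Γ.tau t) (Γ.tau s) n (Finsupp.single α 1)) := by
    simp only [antisymmetrizer, altProd, LinearMap.add_apply, LinearMap.smul_apply,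
      Module.End.mul_apply, LinearMap.sub_apply, Module.algebraMap_end_apply, smul_sub, smul_neg,
      smul_add]
    rw [smul_comm (uVar ^ 2) ((-1 : HeckeField) ^ n)]
    abel
  rw [h2]
  refine smul_mem_vanishingLattice X (by simp [uVar_eq, sq]) (Submodule.add_mem _ ?_ ?_)
  · exact antisymmetrizer_mem_coeffLattice s t n h1
  · exact smul_mem_coeffLattice ((-1) ^ n) (by simp) (altProd_tau_mem_coeffLattice t s n h1)

/-! ### Weighted directed paths. -/

/-- There is a directed path from the first to the second vertex along edges with labels in `L`,
with the given product of the ratios `sgnRatio`. -/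
inductive WeightedPath (Γ : LabeledDigraph S V) (L : Set S) : V → V → HeckeField → Prop
  | refl (α : V) : WeightedPath Γ L α α 1
  | cons {e : LabeledEdge S V} {β : V} {w : HeckeField} (he : e ∈ Γ.edges) (hL : e.label ∈ L)
      (h : WeightedPath Γ L e.tgt β w) : WeightedPath Γ L e.src β (e.kind.sgnRatio * w)

namespace WeightedPath

variable {L : Set S} {α β γ : V} {v w : HeckeField}

theorem trans (h : Γ.WeightedPath L α β v) (h' : Γ.WeightedPath L β γ w) :
    Γ.WeightedPath L α γ (v * w) := by
  induction h with
  | refl => simpa using h'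
  | cons he hL _ ih =>
    rw [mul_assoc]
    exact cons he hL (ih h')

theorem mono {L' : Set S} (hL : L ⊆ L') (h : Γ.WeightedPath L α β w) :
    Γ.WeightedPath L' α β w := by
  induction h with
  | refl => exact refl _
  | cons he h _ ih => exact cons he (hL h) ih

theorem weight_ne_zero (h : Γ.WeightedPath L α β w) : w ≠ 0 := by
  induction h with
  | refl => exact one_ne_zero
  | cons _ _ _ ih => exact mul_ne_zero (EdgeKind.sgnRatio_ne_zero _) ih

theorem apply_eq (h : Γ.WeightedPath L α β w) {y : V → HeckeField}
    (hy : ∀ e ∈ Γ.edges, e.label ∈ L → y e.src = e.kind.sgnRatio * y e.tgt) :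
    y α = w * y β := by
  induction h with
  | refl => simp
  | cons he hL _ ih => rw [hy _ he hL, ih, mul_assoc]

/-- A move has length one if `α` is the source of its `s`-edge and zero if it is the target, so
sequences of moves are directed paths. -/
theorem of_edgeAt_tgt {s : S} (hs : s ∈ L) (α : V) :
    ∃ w, Γ.WeightedPath L α (Γ.edgeAt s α).tgt w := by
  obtain ⟨he, hl, h⟩ := Γ.edgeAt_spec s α
  generalize Γ.edgeAt s α = e at *
  subst hl
  rcases h with rfl | rfl
  · exact ⟨_, cons he hs (refl _)⟩
  · exact ⟨1, refl _⟩

end WeightedPath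

/-- One of the two alternating sequences of `n + 1` moves starts along `s`, the other one
along `t`. -/
theorem exists_weightedPath_push {L : Set S} {s t : S} (hs : s ∈ L) (ht : t ∈ L) (n : ℕ) (α : V) :
    ((∃ w, Γ.WeightedPath L (Γ.edgeAt s α).tgt (Γ.push s t (n + 1) α) w) ∧
      ∃ w, Γ.WeightedPath L (Γ.edgeAt t α).tgt (Γ.push t s (n + 1) α) w) ∨
    ((∃ w, Γ.WeightedPath L (Γ.edgeAt s α).tgt (Γ.push t s (n + 1) α) w) ∧
      ∃ w, Γ.WeightedPath L (Γ.edgeAt t α).tgt (Γ.push s t (n + 1) α) w) := by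
  have step {x : V} {p q : S} {m : ℕ} (hp : p ∈ L)
      (h : ∃ w, Γ.WeightedPath L x (Γ.push q p m α) w) :
      ∃ w, Γ.WeightedPath L x (Γ.push p q (m + 1) α) w := by
    obtain ⟨w, h⟩ := h
    obtain ⟨w', h'⟩ := WeightedPath.of_edgeAt_tgt (Γ := Γ) hp (Γ.push q p m α)
    exact ⟨_, h.trans h'⟩
  induction n with
  | zero => exact Or.inl ⟨⟨1, WeightedPath.refl _⟩, ⟨1, WeightedPath.refl _⟩⟩
  | succ n ih =>
    rcases ih with ⟨h1, h2⟩ | ⟨h1, h2⟩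
    · exact Or.inr ⟨step ht h1, step hs h2⟩
    · exact Or.inl ⟨step hs h1, step ht h2⟩

/-! ### Local confluence. -/

section WDigraph

variable {W : Type*} [Group W] {M : CoxeterMatrix S} {cs : CoxeterSystem M W}

theorem IsWDigraph.tau_quadratic (h : Γ.IsWDigraph cs) (s : S) :
    (Γ.tau s - algebraMap HeckeField _ (uVar ^ 2)) * (Γ.tau s + 1) = 0 := by
  have h1 := congrArg h.rep (RingQuot.mkAlgHom_rel HeckeField (HeckeRel.quadratic (M := M) s))
  rw [map_mul, map_sub, map_add, map_zero, map_one, AlgHom.commutes] at h1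
  rw [map_mul, map_sub, map_add, map_zero, map_one, AlgHom.commutes] at h1
  rw [← h.rep_T]
  exact h1

theorem IsWDigraph.tau_braid (h : Γ.IsWDigraph cs) {s t : S} (hst : s ≠ t) (hfin : M s t ≠ 0) :
    altProd (Γ.tau s) (Γ.tau t) (M s t) = altProd (Γ.tau t) (Γ.tau s) (M s t) := by
  have h1 := congrArg h.rep
    (RingQuot.mkAlgHom_rel HeckeField (HeckeRel.braid (M := M) s t hst hfin))
  simp only [HeckeAlgebra.map_altProd] at h1
  rw [← h.rep_T, ← h.rep_T]
  exact h1

/-- Two edges with the same source and with labels `s`, `t` such that `n(s,t) < ∞` can be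
completed to two directed paths with the same target and the same weight. -/
theorem IsWDigraph.local_confluence (h : Γ.IsWDigraph cs) {e f : LabeledEdge S V}
    (he : e ∈ Γ.edges) (hf : f ∈ Γ.edges) (hsrc : e.src = f.src)
    (hfin : M e.label f.label ≠ 0) :
    ∃ x v w, Γ.WeightedPath Set.univ e.tgt x v ∧ Γ.WeightedPath Set.univ f.tgt x w ∧
      e.kind.sgnRatio * v = f.kind.sgnRatio * w := by
  by_cases hst : e.label = f.label
  · have hef : e = f := by
      rw [← edgeAt_src he, hst, hsrc, edgeAt_src hf]
    exact ⟨e.tgt, 1, 1, .refl _, hef ▸ .refl _, by rw [hef]⟩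
  have hbr := h.tau_braid hst hfin
  obtain ⟨n, hn⟩ := Nat.exists_eq_succ_of_ne_zero hfin
  rw [hn] at hbr
  have hsw := antisymmetrizer_swap (A := End HeckeField (V →₀ HeckeField)) (q := uVar ^ 2) hbr
  set y := antisymmetrizer (uVar ^ 2) (Γ.tau e.label) (Γ.tau f.label) (n + 1)
    (Finsupp.single e.src 1) with hy
  have hy' : y = antisymmetrizer (uVar ^ 2) (Γ.tau f.label) (Γ.tau e.label) (n + 1)
    (Finsupp.single e.src 1) := by rw [hy, hsw]
  have h1 : Γ.tau e.label y = -y := by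
    rw [hy, ← Module.End.mul_apply, mul_antisymmetrizer (h.tau_quadratic _), LinearMap.neg_apply]
  have h2 : Γ.tau f.label y = -y := by
    rw [hy', ← Module.End.mul_apply, mul_antisymmetrizer (h.tau_quadratic _), LinearMap.neg_apply]
  rw [tau_eq_neg_iff] at h1 h2
  have hs1 := specializesTo_antisymmetrizer (Γ := Γ) e.label f.label n e.src
  have hs2 := specializesTo_antisymmetrizer (Γ := Γ) f.label e.label n e.src
  rw [← hy] at hs1
  rw [← hy'] at hs2
  have hx := hs1.unique hs2
  -- Which word starts along which edge depends on the parity of `n`; since both words end at the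
  -- same vertex, the two cases coincide.
  have hpath := exists_weightedPath_push (Γ := Γ) (L := {e.label, f.label}) (s := e.label)
    (t := f.label) (by simp) (by simp) n e.src
  rw [← hx, or_self, edgeAt_src he, hsrc, edgeAt_src hf, ← hsrc] at hpath
  obtain ⟨⟨v, hv⟩, w, hw⟩ := hpath
  refine ⟨_, v, w, hv.mono (Set.subset_univ _), hw.mono (Set.subset_univ _), ?_⟩
  have hyE : ∀ g ∈ Γ.edges, g.label ∈ ({e.label, f.label} : Set S) →
      y g.src = g.kind.sgnRatio * y g.tgt := by
    rintro g hg (hl | hl)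
    · exact h1 g hg hl
    · exact h2 g hg hl
  -- Multiplied by the nonzero coefficient of `y` at the common endpoint, both weights become the
  -- coefficient of `y` at the source of the fork.
  refine mul_right_cancel₀ hs1.apply_ne_zero ?_
  rw [mul_assoc, mul_assoc, ← hv.apply_eq hyE, ← hw.apply_eq hyE, ← h1 e he rfl, hsrc,
    ← h2 f hf rfl]

end WDigraph

/-! ### Sinks and global confluence in acyclic components. -/

/-- The vertex `α` is the source of no edge. -/
def IsSink (Γ : LabeledDigraph S V) (α : V) : Prop := ∀ β, ¬ Γ.Step α β

theorem Step.reachable {α β : V} (h : Γ.Step α β) : Γ.undir.Reachable α β := by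
  obtain ⟨e, he, rfl, rfl⟩ := h
  exact SimpleGraph.Adj.reachable
    ((SimpleGraph.fromRel_adj _ _ _).2 ⟨Γ.no_loops e he, Or.inl ⟨e, he, rfl, rfl⟩⟩)

theorem component_src_eq {e : LabeledEdge S V} (he : e ∈ Γ.edges) :
    Γ.undir.connectedComponentMk e.src = Γ.undir.connectedComponentMk e.tgt :=
  SimpleGraph.ConnectedComponent.sound (Step.reachable ⟨e, he, rfl, rfl⟩)

/-- Acyclicity makes the transitive closure of the steps irreflexive on `C`, and a transitive
irreflexive relation on a finite set is well founded. -/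
theorem Component.IsAcyclic.wellFounded [Finite V] {C : Γ.Component} (hC : C.IsAcyclic) :
    WellFounded fun β α : V => α ∈ C.supp ∧ Γ.Step α β := by
  let r : V → V → Prop := fun β α => α ∈ C.supp ∧ Relation.TransGen Γ.Step α β
  have : IsTrans V r := ⟨fun _ _ _ h h' => ⟨h'.1, h'.2.trans h.2⟩⟩
  have : Std.Irrefl r := ⟨fun α h => hC α h.1 h.2⟩
  have hwf : WellFounded r := Finite.wellFounded_of_trans_of_irrefl r
  exact Subrelation.wf (fun h => ⟨h.1, .single h.2⟩) hwf

theorem Component.src_mem_supp_iff {C : Γ.Component} {e : LabeledEdge S V} (he : e ∈ Γ.edges) :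
    e.src ∈ C.supp ↔ e.tgt ∈ C.supp := by
  rw [SimpleGraph.ConnectedComponent.mem_supp_iff, SimpleGraph.ConnectedComponent.mem_supp_iff,
    component_src_eq he]

theorem Component.IsAcyclic.exists_path_sink [Finite V] {C : Γ.Component} (hC : C.IsAcyclic)
    {α : V} (hα : α ∈ C.supp) : ∃ ω w, Γ.IsSink ω ∧ Γ.WeightedPath Set.univ α ω w := by
  induction α using hC.wellFounded.induction with
  | _ α ih =>
    by_cases h : Γ.IsSink α
    · exact ⟨α, 1, h, .refl α⟩
    · simp only [IsSink, not_forall, not_not] at h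
      obtain ⟨_, e, he, rfl, rfl⟩ := h
      obtain ⟨ω, w, hω, hp⟩ := ih e.tgt ⟨hα, e, he, rfl, rfl⟩ ((src_mem_supp_iff he).1 hα)
      exact ⟨ω, _, hω, .cons he (Set.mem_univ _) hp⟩

theorem WeightedPath.mem_supp {L : Set S} {C : Γ.Component} {α β : V} {w : HeckeField}
    (h : Γ.WeightedPath L α β w) (hα : α ∈ C.supp) : β ∈ C.supp := by
  induction h with
  | refl => exact hα
  | cons he _ _ ih => exact ih ((Component.src_mem_supp_iff he).1 hα)

/-- All directed paths from a given vertex of an acyclic component to a sink have the same target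
and the same weight. -/
theorem IsWDigraph.unique_sink [Finite V] {W : Type*} [Group W] {M : CoxeterMatrix S}
    {cs : CoxeterSystem M W} (h : Γ.IsWDigraph cs) (hM : ∀ s t, M s t ≠ 0) {C : Γ.Component}
    (hC : C.IsAcyclic) {α : V} (hα : α ∈ C.supp) {ω ω' : V} {w w' : HeckeField}
    (hω : Γ.IsSink ω) (hω' : Γ.IsSink ω') (hw : Γ.WeightedPath Set.univ α ω w)
    (hw' : Γ.WeightedPath Set.univ α ω' w') : ω = ω' ∧ w = w' := by
  induction α using hC.wellFounded.induction generalizing ω ω' w w' with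
  | _ α ih =>
    cases hw with
    | refl =>
      cases hw' with
      | refl => exact ⟨rfl, rfl⟩
      | cons he _ _ => exact (hω _ ⟨_, he, rfl, rfl⟩).elim
    | @cons e _ w he _ hp =>
      generalize hsrc : e.src = α at *
      cases hw' with
      | refl => exact (hω' _ ⟨e, he, hsrc, rfl⟩).elim
      | @cons f _ w' hf _ hp' =>
        obtain ⟨x, a, b, ha, hb, hab⟩ := h.local_confluence he hf hsrc (hM _ _)
        have heC : e.tgt ∈ C.supp := (Component.src_mem_supp_iff he).1 (hsrc ▸ hα)
        have hfC : f.tgt ∈ C.supp := (Component.src_mem_supp_iff hf).1 hα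
        -- Continue from the vertex closing the fork to some sink `z`; induction at the two targets
        -- identifies both given paths with paths through that vertex.
        obtain ⟨z, c, hz, hc⟩ := hC.exists_path_sink (ha.mem_supp heC)
        obtain ⟨rfl, rfl⟩ := ih e.tgt ⟨hα, e, he, hsrc, rfl⟩ heC hω hz hp (ha.trans hc)
        obtain ⟨rfl, rfl⟩ := ih f.tgt ⟨hα, f, hf, rfl, rfl⟩ hfC hω' hω hp' (hb.trans hc)
        exact ⟨rfl, by rw [← mul_assoc, hab, mul_assoc]⟩

/-! ### Circuits and dimension counting. -/

/-- If there is a nonempty directed circuit through `α`, then a vector on which all `T_s` act by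
`-1` has coefficient zero at `α`. -/
theorem apply_eq_zero_of_circuit {y : V → HeckeField}
    (hy : ∀ e ∈ Γ.edges, y e.src = e.kind.sgnRatio * y e.tgt) {α : V}
    (hα : Relation.TransGen Γ.Step α α) : y α = 0 := by
  have key {β γ : V} (h : Relation.TransGen Γ.Step β γ) :
      ∃ w, VanishesAtZero w ∧ y β = w * y γ := by
    induction h with
    | single h =>
      obtain ⟨e, he, rfl, rfl⟩ := h
      exact ⟨_, e.kind.vanishesAtZero_sgnRatio, hy e he⟩
    | tail _ h ih =>
      obtain ⟨e, he, rfl, rfl⟩ := h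
      obtain ⟨w, hw, h⟩ := ih
      exact ⟨_, hw.mul e.kind.vanishesAtZero_sgnRatio, by rw [h, hy e he, mul_assoc]⟩
  obtain ⟨w, hw, h⟩ := key hα
  have h1 : (1 - w) * y α = 0 := by linear_combination h
  exact (mul_eq_zero.1 h1).resolve_left (sub_ne_zero.2 hw.ne_one.symm)

/-- A function that agrees at the two ends of each edge is constant on components. -/
theorem eq_of_reachable {X : Type*} {g : V → X} (hg : ∀ e ∈ Γ.edges, g e.src = g e.tgt) {α β : V}
    (h : Γ.undir.Reachable α β) : g α = g β := by
  obtain ⟨p⟩ := h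
  induction p with
  | nil => rfl
  | cons hadj _ ih =>
    rw [← ih]
    rcases ((SimpleGraph.fromRel_adj _ _ _).1 hadj).2 with ⟨e, he, rfl, rfl⟩ | ⟨e, he, rfl, rfl⟩
    · exact hg e he
    · exact (hg e he).symm

/-- The dimension of the space of vectors whose coefficients at the two ends of each edge have a
prescribed ratio, given one such vector whose support consists of the components on which a nonzero
such vector exists. -/
theorem finrank_eq_card_components [Finite V] (c : EdgeKind → HeckeField) (hc : ∀ k, c k ≠ 0)
    (E : Submodule HeckeField (V →₀ HeckeField))
    (hE : ∀ y, y ∈ E ↔ ∀ e ∈ Γ.edges, y e.src = c e.kind * y e.tgt) (P : Γ.Component → Prop)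
    (v : V → HeckeField) (hv : ∀ e ∈ Γ.edges, v e.src = c e.kind * v e.tgt)
    (hvP : ∀ α, v α ≠ 0 ↔ P (Γ.undir.connectedComponentMk α))
    (hyP : ∀ y ∈ E, ∀ α, v α = 0 → y α = 0) :
    Nat.card {C : Γ.Component // P C} = finrank HeckeField E := by
  classical
  have : Fintype V := Fintype.ofFinite V
  have : Fintype {C : Γ.Component // P C} := Fintype.ofFinite _
  let pt (C : {C : Γ.Component // P C}) : V := C.1.out
  have hpt (C : {C : Γ.Component // P C}) : Γ.undir.connectedComponentMk (pt C) = C.1 :=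
    Quot.out_eq C.1
  have hvpt (C : {C : Γ.Component // P C}) : v (pt C) ≠ 0 := (hvP _).2 ((hpt C).symm ▸ C.2)
  let φ : E →ₗ[HeckeField] ({C : Γ.Component // P C} → HeckeField) :=
    { toFun := fun y C => y.1 (pt C)
      map_add' := fun _ _ => rfl
      map_smul' := fun _ _ => rfl }
  -- `y` and `v` satisfy the same edge equations, so their quotient is locally constant; where `v`
  -- vanishes, division by zero gives the harmless value 0.
  have ratio (y : E) {α β : V} (h : Γ.undir.Reachable α β) : y.1 α / v α = y.1 β / v β := by
    refine eq_of_reachable (g := fun γ => y.1 γ / v γ) (fun e he => ?_) h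
    rw [(hE _).1 y.2 e he, hv e he, mul_div_mul_left _ _ (hc _)]
  have hinj : Function.Injective φ := by
    intro y z hyz
    ext α
    by_cases h0 : v α = 0
    · rw [hyP _ y.2 α h0, hyP _ z.2 α h0]
    · let C : {C : Γ.Component // P C} := ⟨_, (hvP α).1 h0⟩
      have hC := SimpleGraph.ConnectedComponent.exact (hpt C)
      have h1 : y.1 (pt C) = z.1 (pt C) := congrFun hyz C
      rw [← div_left_inj' h0, ← ratio y hC, ← ratio z hC, h1]
  have hsurj : Function.Surjective φ := by
    intro f
    -- Rescale `v` on each component to take the prescribed value at the chosen vertex.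
    let g (C : Γ.Component) : HeckeField := if h : P C then f ⟨C, h⟩ / v (pt ⟨C, h⟩) else 0
    refine ⟨⟨Finsupp.equivFunOnFinite.symm
      fun α => g (Γ.undir.connectedComponentMk α) * v α, ?_⟩, ?_⟩
    · rw [hE]
      intro e he
      simp only [Finsupp.equivFunOnFinite_symm_apply_apply]
      rw [component_src_eq he, hv e he]
      ring
    · ext C
      change g (Γ.undir.connectedComponentMk (pt C)) * v (pt C) = f C
      rw [hpt]
      simp only [g, dif_pos C.2]
      exact div_mul_cancel₀ _ (hvpt C)
  rw [(LinearEquiv.ofBijective φ ⟨hinj, hsurj⟩).finrank_eq, finrank_fintype_fun_eq_card,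
    Nat.card_eq_fintype_card]

/-! ### The two character spaces. -/

section WDigraph

variable {W : Type*} [Group W] {M : CoxeterMatrix S} {cs : CoxeterSystem M W}

theorem IsWDigraph.mem_charSpace_ind (h : Γ.IsWDigraph cs) (y : V →₀ HeckeField) :
    y ∈ charSpace h.rep (HeckeAlgebra.ind cs) ↔ ∀ e ∈ Γ.edges, y e.src = y e.tgt := by
  simp only [mem_charSpace_iff, h.rep_T, HeckeAlgebra.ind, HeckeAlgebra.linearChar_T,
    tau_eq_ind_iff]
  exact ⟨fun h e he => h _ e he rfl, fun h _ e he _ => h e he⟩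

theorem IsWDigraph.mem_charSpace_sgn (h : Γ.IsWDigraph cs) (y : V →₀ HeckeField) :
    y ∈ charSpace h.rep (HeckeAlgebra.sgn cs) ↔
      ∀ e ∈ Γ.edges, y e.src = e.kind.sgnRatio * y e.tgt := by
  simp only [mem_charSpace_iff, h.rep_T, HeckeAlgebra.sgn, HeckeAlgebra.linearChar_T,
    neg_one_smul, tau_eq_neg_iff]
  exact ⟨fun h e he => h _ e he rfl, fun h _ e he _ => h e he⟩

/-- There is a vector whose support is the union of the acyclic components and on which all `T_s`
act by `-1`. -/
theorem IsWDigraph.exists_sgn_vector [Finite V] (h : Γ.IsWDigraph cs) (hM : ∀ s t, M s t ≠ 0) :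
    ∃ v : V → HeckeField, (∀ e ∈ Γ.edges, v e.src = e.kind.sgnRatio * v e.tgt) ∧
      ∀ α, v α ≠ 0 ↔ Component.IsAcyclic (Γ.undir.connectedComponentMk α) := by
  classical
  have hex (α : V) : ∃ w : HeckeField,
      (Component.IsAcyclic (Γ.undir.connectedComponentMk α) →
        ∃ ω, Γ.IsSink ω ∧ Γ.WeightedPath Set.univ α ω w) ∧
      (¬ Component.IsAcyclic (Γ.undir.connectedComponentMk α) → w = 0) := by
    by_cases hC : Component.IsAcyclic (Γ.undir.connectedComponentMk α)
    · obtain ⟨ω, w, hω, hw⟩ := hC.exists_path_sink rfl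
      exact ⟨w, fun _ => ⟨ω, hω, hw⟩, fun h => (h hC).elim⟩
    · exact ⟨0, fun h => (hC h).elim, fun _ => rfl⟩
  choose v hv hv0 using hex
  refine ⟨v, fun e he => ?_, fun α => ⟨fun h0 => ?_, fun hC => ?_⟩⟩
  · by_cases hC : Component.IsAcyclic (Γ.undir.connectedComponentMk e.src)
    · obtain ⟨ω, hω, hw⟩ := hv _ hC
      obtain ⟨ω', hω', hw'⟩ := hv e.tgt (component_src_eq he ▸ hC)
      -- The edge `e` followed by the path chosen at its target competes with the path chosen at its
      -- source.
      exact (h.unique_sink hM hC rfl hω hω' hw (.cons he (Set.mem_univ _) hw')).2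
    · rw [hv0 _ hC, hv0 e.tgt (component_src_eq he ▸ hC), mul_zero]
  · by_contra hC
    exact h0 (hv0 _ hC)
  · obtain ⟨ω, -, hw⟩ := hv α hC
    exact hw.weight_ne_zero

end WDigraph

end LabeledDigraph

end

theorem theorem5 {S W V : Type*} [Group W] {M : CoxeterMatrix S} (cs : CoxeterSystem M W)
    [Finite V] (Γ : LabeledDigraph S V) (hΓ : Γ.IsWDigraph cs) :
    Nat.card Γ.Component = finrank HeckeField (charSpace hΓ.rep (HeckeAlgebra.ind cs)) ∧
    ((∀ s t : S, M s t ≠ 0) →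
      Nat.card {C : Γ.Component // C.IsAcyclic} =
        finrank HeckeField (charSpace hΓ.rep (HeckeAlgebra.sgn cs))) := by
  constructor
  · rw [← Nat.card_congr (Equiv.subtypeUnivEquiv (p := fun _ : Γ.Component => True)
      fun _ => trivial)]
    exact LabeledDigraph.finrank_eq_card_components (fun _ => 1) (fun _ => one_ne_zero) _
      (fun y => by simpa using hΓ.mem_charSpace_ind y) _ (fun _ => 1) (by simp) (by simp)
      (by simp)
  · intro hM
    obtain ⟨v, hv, hvP⟩ := hΓ.exists_sgn_vector hM
    refine LabeledDigraph.finrank_eq_card_components _ EdgeKind.sgnRatio_ne_zero _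
      hΓ.mem_charSpace_sgn _ v hv hvP ?_
    intro y hy α hα
    rw [hΓ.mem_charSpace_sgn] at hy
    have hC := (not_iff_not.2 (hvP α)).1 (not_not.2 hα)
    simp only [LabeledDigraph.Component.IsAcyclic, not_forall, not_not] at hC
    obtain ⟨β, hβ, hcirc⟩ := hC
    have hzero := LabeledDigraph.apply_eq_zero_of_circuit hy hcirc
    -- The ratios are nonzero, so vanishing spreads from the circuit to its whole component.
    have hcongr := LabeledDigraph.eq_of_reachable (g := fun γ => y γ = 0)
      (fun e he => by simp [hy e he, EdgeKind.sgnRatio_ne_zero])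
      (SimpleGraph.ConnectedComponent.exact hβ)
    exact hcongr.mp hzero
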